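/- Let $\mathcal L=\{(x,y)\in\mathbb Z^2 : x+y\equiv 0 \bmod 2\}$ and fix an integer $l\ge 2$. Consider lattice paths in $\mathcal L$ starting at $(0,0)$ with steps $(x,y)\to(x\pm1,y+1)$ that obey the following restrictions. * Left wall at $x=0$: from a point with $x=0$ only the step to $x=1$ is allowed. * Filter of type 1 at $x=d$, for $d=l-1$: from $x=d$ only the step to $x=d+1$ is allowed (weight $1$); from $x=d+1$ the step to $x=d+2$ (weight $1$) and the step to $x=d$ (weight $2$) are allowed. * Filters of type 2 at $x=d$, for $d=nl-1$ with every integer $n\ge2$: from $x=d$ only the step to $x=d+1$ is allowed; from $x=d+1$ the steps to $x=d+2$ and to $x=d$ are allowed; the two steps arriving at $x=d$ (from $x=d-1$ and from $x=d+1$) have weight $2$. All steps to which no restriction gives weight $2$ have weight $1$. The weight of a path is the product of the weights of its steps. Let $(M,N)\in\mathcal L$ with $N\ge 0$, and suppose $j=\left\lfloor\frac{M+1}{l}+1\right\rfloor\ge2$, i.e. $(j-1)l-1\le M\le jl-2$ (the endpoint lies in the $j$-th strip). Let $M^j_{(M,N)}$ be the sum of the weights of all such paths from $(0,0)$ to $(M,N)$.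 Then $$ \begin{aligned} M^{j}_{(M,N)} = 2^{j-2}\Bigg(&\sum_{k=0}^{\left\lfloor\frac{N-(j-1)l+1}{4l}\right\rfloor}P_j(k)\, F^{(N)}_{M+4kl}+\sum_{k=0}^{\left\lfloor\frac{N-jl}{4l}\right\rfloor}P_j(k)\,F^{(N)}_{M-4kl-2jl}\\ &-\sum_{k=0}^{\left\lfloor\frac{N-(j+1)l+1}{4l}\right\rfloor}Q_j(k)\,F^{(N)}_{M+2l+4kl}-\sum_{k=0}^{\left\lfloor\frac{N-(j+2)l}{4l}\right\rfloor}Q_j(k)\,F^{(N)}_{M-4kl-2(j+1)l}\Bigg), \end{aligned} $$ where $$P_j(k)=\sum_{i=0}^{\lfloor j/2\rfloor}\binom{j-2}{2i}\binom{k-i+j-2}{j-2},\qquad Q_j(k)=\sum_{i=0}^{\lfloor j/2\rfloor}\binom{j-2}{2i+1}\binom{k-i+j-2}{j-2},$$ $$F^{(N)}_M=\binom{N}{\frac{N-M}{2}}-\binom{N}{\frac{N-M}{2}-1}.$$ Here $\binom{n}{m}=0$ unless $0\le m\le n$, and a sum with negative upper limit is empty. -/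

import Mathlib

namespace FilterPaths

/-- The lattice `𝓛` of integer points whose coordinates have an even sum. -/
def lattice : Set (ℤ × ℤ) := {p | 2 ∣ p.1 + p.2}

/-- The steps `(x, y) → (x ± 1, y + 1)`. -/
def IsStep (p q : ℤ × ℤ) : Prop :=
  (q.1 = p.1 + 1 ∨ q.1 = p.1 - 1) ∧ q.2 = p.2 + 1

/-- A restriction on paths: it says which steps `p → q` it allows and to which of them it gives
the weight `2` instead of the default weight `1`. -/
structure Restriction where
  allowed : ℤ × ℤ → ℤ × ℤ → Prop
  doubled : ℤ × ℤ → ℤ × ℤ → Prop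

/-- The left wall at `x = d`: from `x = d` only the step to `x = d + 1` is allowed. -/
def leftWall (d : ℤ) : Restriction where
  allowed p q := p.1 = d → q.1 = d + 1
  doubled _ _ := False

/-- The filter of type 1 at `x = d`. From `x = d` only the step to `x = d + 1` is allowed; from
`x = d + 1` there are a step to `x = d + 2` and a step to `x = d`, the latter of weight `2`. -/
def filterOne (d : ℤ) : Restriction where
  allowed p q := (p.1 = d → q.1 = d + 1) ∧ (p.1 = d + 1 → q.1 = d + 2 ∨ q.1 = d)
  doubled p q := p.1 = d + 1 ∧ q.1 = d

/-- The filter of type 2 at `x = d`. It allows the same steps as the filter of type 1; both steps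
that arrive at `x = d`, from `x = d - 1` and from `x = d + 1`, have weight `2`. -/
def filterTwo (d : ℤ) : Restriction where
  allowed p q := (p.1 = d → q.1 = d + 1) ∧ (p.1 = d + 1 → q.1 = d + 2 ∨ q.1 = d)
  doubled p q := (p.1 = d - 1 ∧ q.1 = d) ∨ (p.1 = d + 1 ∧ q.1 = d)

/-- The set of lattice paths `P 0, P 1, …, P N` with `N` steps from `A` to `B` that obey all
restrictions in `C`. -/
def pathSet (C : Set Restriction) (N : ℕ) (A B : ℤ × ℤ) : Set (Fin (N + 1) → ℤ × ℤ) :=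
  {P | P 0 = A ∧ P (Fin.last N) = B ∧ (∀ i, P i ∈ lattice) ∧
    ∀ i : Fin N, IsStep (P i.castSucc) (P i.succ) ∧
      ∀ R ∈ C, R.allowed (P i.castSucc) (P i.succ)}

open Classical in
/-- The weight of a step: `2` if some restriction doubles it, and `1` otherwise. -/
noncomputable def stepWeight (C : Set Restriction) (p q : ℤ × ℤ) : ℤ :=
  if ∃ R ∈ C, R.doubled p q then 2 else 1

/-- The weight of a path, the product of the weights of its steps. -/
noncomputable def pathWeight (C : Set Restriction) {N : ℕ} (P : Fin (N + 1) → ℤ × ℤ) : ℤ :=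
  ∏ i : Fin N, stepWeight C (P i.castSucc) (P i.succ)

theorem pathSet_finite (C : Set Restriction) (N : ℕ) (A B : ℤ × ℤ) :
    (pathSet C N A B).Finite := by
  have key : pathSet C N A B ⊆ Set.pi Set.univ
      (fun _ : Fin (N + 1) => Set.Icc (A.1 - N) (A.1 + N) ×ˢ Set.Icc (A.2 - N) (A.2 + N)) := by
    intro P hP i _
    obtain ⟨h0, _, _, hs⟩ := hP
    have hb : ∀ (k : ℕ) (hk : k < N + 1),
        A.1 - k ≤ (P ⟨k, hk⟩).1 ∧ (P ⟨k, hk⟩).1 ≤ A.1 + k ∧ (P ⟨k, hk⟩).2 = A.2 + k := by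
      intro k
      induction k with
      | zero =>
        intro hk
        have h00 : P ⟨0, hk⟩ = A := h0
        rw [h00]
        simp
      | succ k ih =>
        intro hk
        obtain ⟨i1, i2, i3⟩ := ih (by omega)
        have h1 := (hs ⟨k, by omega⟩).1
        simp only [IsStep, Fin.castSucc_mk, Fin.succ_mk] at h1
        push_cast
        omega
    have h := hb i i.isLt
    have hi : (i : ℕ) ≤ N := by omega
    simp only [Fin.eta] at h
    simp only [Set.mem_prod, Set.mem_Icc]
    omega
  exact (Set.Finite.pi fun _ => (Set.finite_Icc _ _).prod (Set.finite_Icc _ _)).subset key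

/-- The weighted number of paths. The sum is finite by `pathSet_finite`. -/
noncomputable def weightedCount (C : Set Restriction) (N : ℕ) (A B : ℤ × ℤ) : ℤ :=
  ∑ P ∈ (pathSet_finite C N A B).toFinset, pathWeight C P

/-- The wall at `x = 0`, the filter of type 1 at `x = l - 1`, and the filters of type 2 at
`x = n l - 1` for `n ≥ 2`. -/
def arrangement (l : ℕ) : Set Restriction :=
  {leftWall 0, filterOne ((l : ℤ) - 1)} ∪
    {R | ∃ n : ℕ, 2 ≤ n ∧ R = filterTwo ((n : ℤ) * l - 1)}

/-- The binomial coefficient `n` choose `m`, equal to `0` unless `0 ≤ m ≤ n`. -/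
def binom (n m : ℤ) : ℤ :=
  if 0 ≤ m ∧ m ≤ n then (n.toNat.choose m.toNat : ℤ) else 0

/-- `F^{(N)}_M`, used for `N - M` even only. -/
def F (N M : ℤ) : ℤ := binom N ((N - M) / 2) - binom N ((N - M) / 2 - 1)

def P (j : ℕ) (k : ℤ) : ℤ :=
  ∑ i ∈ Finset.range (j / 2 + 1),
    binom ((j : ℤ) - 2) (2 * (i : ℤ)) * binom (k - (i : ℤ) + (j : ℤ) - 2) ((j : ℤ) - 2)

def Q (j : ℕ) (k : ℤ) : ℤ :=
  ∑ i ∈ Finset.range (j / 2 + 1),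
    binom ((j : ℤ) - 2) (2 * (i : ℤ) + 1) * binom (k - (i : ℤ) + (j : ℤ) - 2) ((j : ℤ) - 2)

end FilterPaths

/-!
The filters only let weight flow to the right: a path which has reached `x = n l - 1` never returns
to `x = n l - 2`. Hence the weighted count in a strip evolves freely (each value is the sum of its
two lower neighbours), vanishes just to the right of the strip, and is fed from the preceding strip
at the left end only.

Let `free N M` be the free evolution of `δ₀ - δ₋₂`; it is antisymmetric about `M = -1` and equals
`F^{(N)}_M` on the lattice. Let the power series variable `X` act on functions of `M` as the shift
`M ↦ M + 2l`. With `A₀ = 1 / (1 - X)`, `Aₙ₊₁ = (1 - X)ⁿ / (1 - X²)ⁿ⁺¹` (`stripSeries`), and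
`hₙ = Aₙ · free`, the weighted count in strip `n + 1` is
`cₙ (hₙ (M) - hₙ (2 (n + 1) l - 2 - M))` with `c₀ = 1` and `cₙ₊₁ = 2ⁿ`
(`weightedCount_eq_stripValue`). This expression evolves freely and is antisymmetric about the right
end `(n + 1) l - 1`, so it vanishes there. At the left end, the relation `(1 + X) Aₙ₊₁ = Aₙ`
(`one_add_X_mul_stripSeries`) is exactly the compatibility with the weights of the filter
(`stripValue_left_end`). In the first strip, `(1 - X) A₀ = 1` makes the expression vanish at
`M = -1`, which accounts for the wall (`stripValue_wall`). Finally the even and odd coefficients of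
`Aₙ₊₁` are `P` and `-Q` (`coeff_even_stripSeries`, `coeff_odd_stripSeries`), and the antisymmetry of
`free` turns the reflected terms into the second and fourth sum.
-/

namespace FilterPaths

/-! ### Recurrence for weighted path counts -/

open Classical in
/-- The contribution of a single step: its weight if all restrictions allow it, otherwise `0`. -/
noncomputable def stepCoeff (C : Set Restriction) (p q : ℤ × ℤ) : ℤ :=
  if ∀ R ∈ C, R.allowed p q then stepWeight C p q else 0

theorem snoc_mem_pathSet_iff {C : Set Restriction} {N : ℕ} {A B B' : ℤ × ℤ}
    {p : Fin (N + 1) → ℤ × ℤ} (hp : p (Fin.last N) = B') :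
    (Fin.snoc p B : Fin (N + 1 + 1) → ℤ × ℤ) ∈ pathSet C (N + 1) A B ↔
      p ∈ pathSet C N A B' ∧ B ∈ lattice ∧ IsStep B' B ∧ ∀ R ∈ C, R.allowed B' B := by
  have h0 : (Fin.snoc p B : Fin (N + 1 + 1) → ℤ × ℤ) 0 = p 0 :=
    Fin.snoc_castSucc (α := fun _ => ℤ × ℤ) B p 0
  have hs : ∀ i : Fin N, (Fin.snoc p B : Fin (N + 1 + 1) → ℤ × ℤ) i.castSucc.succ = p i.succ :=
    fun i => Fin.snoc_castSucc (α := fun _ => ℤ × ℤ) B p i.succ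
  simp only [pathSet, Set.mem_ofPred_eq, h0, Fin.snoc_last, true_and,
    Fin.forall_fin_succ' (n := N + 1), Fin.forall_fin_succ' (n := N), Fin.snoc_castSucc, hs,
    Fin.succ_last, hp]
  tauto

theorem pathWeight_snoc (C : Set Restriction) {N : ℕ} (p : Fin (N + 1) → ℤ × ℤ) (B : ℤ × ℤ) :
    pathWeight C (Fin.snoc p B : Fin (N + 1 + 1) → ℤ × ℤ) =
      pathWeight C p * stepWeight C (p (Fin.last N)) B := by
  have hs : ∀ i : Fin N, (Fin.snoc p B : Fin (N + 1 + 1) → ℤ × ℤ) i.castSucc.succ = p i.succ :=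
    fun i => Fin.snoc_castSucc (α := fun _ => ℤ × ℤ) B p i.succ
  simp only [pathWeight, Fin.prod_univ_castSucc (n := N), Fin.snoc_castSucc, hs, Fin.succ_last,
    Fin.snoc_last]

/-- The paths whose last step starts at `B'`. -/
theorem sum_filter_penultimate {C : Set Restriction} {N : ℕ} {A B B' : ℤ × ℤ}
    (hB : B ∈ lattice) (hstep : IsStep B' B) :
    ∑ p ∈ (pathSet_finite C (N + 1) A B).toFinset with p (Fin.last N).castSucc = B',
      pathWeight C p = stepCoeff C B' B * weightedCount C N A B' := by
  classical
  unfold stepCoeff weightedCount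
  split_ifs with hall
  · rw [Finset.mul_sum]
    refine Finset.sum_nbij' (fun p => Fin.init p) (fun p => Fin.snoc p B) ?_ ?_ ?_ ?_ ?_
    · intro p hp
      simp only [Finset.mem_filter, Set.Finite.mem_toFinset] at hp ⊢
      have hlast : p (Fin.last (N + 1)) = B := hp.1.2.1
      have := hp.1
      rw [← Fin.snoc_init_self p, hlast] at this
      exact ((snoc_mem_pathSet_iff (B' := B') hp.2).1 this).1
    · intro p hp
      simp only [Finset.mem_filter, Set.Finite.mem_toFinset] at hp ⊢
      refine ⟨(snoc_mem_pathSet_iff hp.2.1).2 ⟨hp, hB, hstep, hall⟩, ?_⟩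
      rw [Fin.snoc_castSucc]
      exact hp.2.1
    · intro p hp
      simp only [Finset.mem_filter, Set.Finite.mem_toFinset] at hp
      have hlast : p (Fin.last (N + 1)) = B := hp.1.2.1
      simp only [← hlast]
      exact Fin.snoc_init_self p
    · intro p _
      exact Fin.init_snoc (α := fun _ => ℤ × ℤ) B p
    · intro p hp
      simp only [Finset.mem_filter, Set.Finite.mem_toFinset] at hp
      have hlast : p (Fin.last (N + 1)) = B := hp.1.2.1
      have h := pathWeight_snoc C (Fin.init p) B
      have hinit : (Fin.init p : Fin (N + 1) → ℤ × ℤ) (Fin.last N) = B' := hp.2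
      have hself : (Fin.snoc (Fin.init p) B : Fin (N + 1 + 1) → ℤ × ℤ) = p := by
        rw [← hlast]
        exact Fin.snoc_init_self p
      rw [hself, hinit] at h
      rw [h, mul_comm]
  · rw [zero_mul]
    refine Finset.sum_eq_zero fun p hp => (hall ?_).elim
    simp only [Finset.mem_filter, Set.Finite.mem_toFinset] at hp
    have h := (hp.1.2.2.2 (Fin.last N)).2
    have hlast : p (Fin.last N).succ = B := hp.1.2.1
    rwa [hp.2, hlast] at h

theorem weightedCount_of_notMem_lattice {C : Set Restriction} {N : ℕ} {A B : ℤ × ℤ}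
    (hB : B ∉ lattice) : weightedCount C N A B = 0 := by
  refine Finset.sum_eq_zero fun p hp => (hB ?_).elim
  rw [Set.Finite.mem_toFinset] at hp
  rw [← hp.2.1]
  exact hp.2.2.1 _

theorem weightedCount_succ (C : Set Restriction) (N : ℕ) (A : ℤ × ℤ) (x y : ℤ) :
    weightedCount C (N + 1) A (x, y + 1) =
      stepCoeff C (x - 1, y) (x, y + 1) * weightedCount C N A (x - 1, y) +
      stepCoeff C (x + 1, y) (x, y + 1) * weightedCount C N A (x + 1, y) := by
  classical
  by_cases hB : ((x, y + 1) : ℤ × ℤ) ∈ lattice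
  · have hne : ((x - 1, y) : ℤ × ℤ) ≠ (x + 1, y) := by
      intro h
      have := congrArg Prod.fst h
      dsimp only at this
      omega
    rw [← sum_filter_penultimate hB (by simp [IsStep]),
      ← sum_filter_penultimate hB (by simp [IsStep]), ← Finset.sum_pair hne
        (f := fun B' => ∑ p ∈ (pathSet_finite C (N + 1) A (x, y + 1)).toFinset with
          p (Fin.last N).castSucc = B', pathWeight C p), weightedCount]
    refine (Finset.sum_fiberwise_of_maps_to (fun p hp => ?_) _).symm
    rw [Set.Finite.mem_toFinset] at hp
    have h := (hp.2.2.2 (Fin.last N)).1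
    have hlast : p (Fin.last N).succ = (x, y + 1) := hp.2.1
    simp only [IsStep, hlast] at h
    simp only [Finset.mem_insert, Finset.mem_singleton, Prod.ext_iff]
    omega
  · rw [weightedCount_of_notMem_lattice hB, weightedCount_of_notMem_lattice,
      weightedCount_of_notMem_lattice, mul_zero, mul_zero, add_zero] <;>
    · simp only [lattice, Set.mem_ofPred_eq] at hB ⊢
      omega

theorem weightedCount_zero (C : Set Restriction) (x : ℤ) :
    weightedCount C 0 (0, 0) (x, 0) = if x = 0 then 1 else 0 := by
  split_ifs with hx
  · subst hx
    have h : (pathSet_finite C 0 (0, 0) (0, 0)).toFinset = {fun _ => (0, 0)} := by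
      ext p
      simp only [Set.Finite.mem_toFinset, Finset.mem_singleton, pathSet, Set.mem_ofPred_eq]
      constructor
      · intro h
        funext i
        rw [Fin.fin_one_eq_zero i]
        exact h.1
      · rintro rfl
        exact ⟨rfl, rfl, fun _ => by simp [lattice], fun i => i.elim0⟩
    rw [weightedCount, h, Finset.sum_singleton]
    simp [pathWeight]
  · refine Finset.sum_eq_zero fun p hp => (hx ?_).elim
    rw [Set.Finite.mem_toFinset] at hp
    exact congrArg Prod.fst (hp.2.1.symm.trans hp.1)

/-! ### Steps in the arrangement -/

theorem allowed_right (l : ℕ) (x y y' : ℤ) :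
    ∀ R ∈ arrangement l, R.allowed (x - 1, y) (x, y') := by
  rintro R ((rfl | rfl) | ⟨n, -, rfl⟩) <;> simp only [leftWall, filterOne, filterTwo] <;> omega

theorem allowed_left_iff (l : ℕ) (x y y' : ℤ) :
    (∀ R ∈ arrangement l, R.allowed (x + 1, y) (x, y')) ↔
      x + 1 ≠ 0 ∧ ∀ n : ℕ, 1 ≤ n → x + 1 ≠ n * l - 1 := by
  constructor
  · intro h
    refine ⟨fun h0 => ?_, fun n hn hx => ?_⟩
    · have := h (leftWall 0) (Or.inl (Or.inl rfl))
      simp only [leftWall] at this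
      omega
    · rcases hn.eq_or_lt with rfl | hn
      · have := h (filterOne (l - 1)) (Or.inl (Or.inr rfl))
        simp only [filterOne] at this
        push_cast at hx
        omega
      · have := h (filterTwo (n * l - 1)) (Or.inr ⟨n, hn, rfl⟩)
        simp only [filterTwo] at this
        omega
  · rintro ⟨h0, hn⟩ R ((rfl | rfl) | ⟨n, hn2, rfl⟩)
    · simp only [leftWall]
      omega
    · have := hn 1 le_rfl
      push_cast at this
      simp only [filterOne]
      omega
    · have := hn n (by omega)
      simp only [filterTwo]
      omega

theorem doubled_right_iff (l : ℕ) (x y y' : ℤ) :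
    (∃ R ∈ arrangement l, R.doubled (x - 1, y) (x, y')) ↔
      ∃ n : ℕ, 2 ≤ n ∧ x = n * l - 1 := by
  constructor
  · rintro ⟨R, (rfl | rfl) | ⟨n, hn2, rfl⟩, h⟩ <;>
      simp only [leftWall, filterOne, filterTwo] at h
    · omega
    · exact ⟨n, hn2, by omega⟩
  · rintro ⟨n, hn, hx⟩
    refine ⟨_, Or.inr ⟨n, hn, rfl⟩, ?_⟩
    simp only [filterTwo]
    omega

theorem doubled_left_iff (l : ℕ) (x y y' : ℤ) :
    (∃ R ∈ arrangement l, R.doubled (x + 1, y) (x, y')) ↔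
      ∃ n : ℕ, 1 ≤ n ∧ x = n * l - 1 := by
  constructor
  · rintro ⟨R, (rfl | rfl) | ⟨n, hn2, rfl⟩, h⟩ <;>
      simp only [leftWall, filterOne, filterTwo] at h
    · exact ⟨1, le_rfl, by push_cast; omega⟩
    · exact ⟨n, by omega, by omega⟩
  · rintro ⟨n, hn, hx⟩
    rcases hn.eq_or_lt with rfl | hn
    · refine ⟨_, Or.inl (Or.inr rfl), ?_⟩
      simp only [filterOne]
      push_cast at hx
      omega
    · refine ⟨_, Or.inr ⟨n, hn, rfl⟩, ?_⟩
      simp only [filterTwo]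
      omega

/-- The points `n l, …, (n + 1) l - 2` carry no filter. -/
theorem ne_filter_of_mem_strip {l n : ℕ} {x : ℤ} (h1 : (n * l : ℤ) ≤ x)
    (h2 : x ≤ n * l + l - 2) (m : ℕ) : x ≠ m * l - 1 := by
  rintro rfl
  have h3 : n < m := by
    by_contra! h
    have : m * l ≤ n * l := Nat.mul_le_mul_right l h
    zify at this
    omega
  have : (n + 1) * l ≤ m * l := Nat.mul_le_mul_right l h3
  zify at this
  linarith

theorem filter_inj {l n m : ℕ} (hl : 2 ≤ l) (h : (n * l - 1 : ℤ) = m * l - 1) : n = m := by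
  have h' : (n : ℤ) * l = m * l := by linarith
  exact Nat.eq_of_mul_eq_mul_right (by omega : 0 < l) (by exact_mod_cast h')

theorem stepCoeff_right {l : ℕ} {x : ℤ} (h : ∀ m : ℕ, x ≠ m * l - 1) (y y' : ℤ) :
    stepCoeff (arrangement l) (x - 1, y) (x, y') = 1 := by
  rw [stepCoeff, if_pos (allowed_right l x y y'), stepWeight, if_neg]
  rw [doubled_right_iff]
  rintro ⟨m, -, hm⟩
  exact h m hm

theorem stepCoeff_right_filter {l n : ℕ} (hl : 2 ≤ l) {x : ℤ} (hx : x = (n + 1 : ℕ) * l - 1)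
    (y y' : ℤ) :
    stepCoeff (arrangement l) (x - 1, y) (x, y') = if n = 0 then 1 else 2 := by
  rw [stepCoeff, if_pos (allowed_right l x y y'), stepWeight]
  by_cases hn : n = 0
  · rw [if_pos hn, if_neg]
    rw [doubled_right_iff]
    rintro ⟨m, hm, h⟩
    have := filter_inj hl (hx.symm.trans h)
    omega
  · rw [if_neg hn, if_pos]
    rw [doubled_right_iff]
    exact ⟨n + 1, by omega, hx⟩

theorem stepCoeff_left {l : ℕ} {x : ℤ} (hx : 0 ≤ x) (h : ∀ m : ℕ, x ≠ m * l - 1)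
    (h' : ∀ m : ℕ, x + 1 ≠ m * l - 1) (y y' : ℤ) :
    stepCoeff (arrangement l) (x + 1, y) (x, y') = 1 := by
  rw [stepCoeff, if_pos, stepWeight, if_neg]
  · rw [doubled_left_iff]
    rintro ⟨m, -, hm⟩
    exact h m hm
  · rw [allowed_left_iff]
    exact ⟨by omega, fun m _ => h' m⟩

theorem stepCoeff_left_filter {l n : ℕ} {x : ℤ} (hx : x = (n + 1 : ℕ) * l - 1) (hx0 : 0 ≤ x)
    (h' : ∀ m : ℕ, x + 1 ≠ m * l - 1) (y y' : ℤ) :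
    stepCoeff (arrangement l) (x + 1, y) (x, y') = 2 := by
  rw [stepCoeff, if_pos, stepWeight, if_pos]
  · rw [doubled_left_iff]
    exact ⟨n + 1, by omega, hx⟩
  · rw [allowed_left_iff]
    exact ⟨by omega, fun m _ => h' m⟩

theorem stepCoeff_left_of_filter {l n : ℕ} {x : ℤ} (hx : x + 1 = (n + 1 : ℕ) * l - 1)
    (y y' : ℤ) : stepCoeff (arrangement l) (x + 1, y) (x, y') = 0 := by
  rw [stepCoeff, if_neg]
  rw [allowed_left_iff]
  exact fun h => h.2 (n + 1) (by omega) hx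

theorem stepCoeff_left_wall (l : ℕ) (y y' : ℤ) :
    stepCoeff (arrangement l) (-1 + 1, y) (-1, y') = 0 := by
  rw [stepCoeff, if_neg]
  rw [allowed_left_iff]
  exact fun h => h.1 (by omega)

theorem weightedCount_of_neg (l N : ℕ) {x : ℤ} (hx : x < 0) :
    weightedCount (arrangement l) N (0, 0) (x, (N : ℤ)) = 0 := by
  induction N generalizing x with
  | zero => rw [Nat.cast_zero, weightedCount_zero, if_neg hx.ne]
  | succ N ih =>
    rw [Nat.cast_succ, weightedCount_succ, ih (by omega : x - 1 < 0), mul_zero, zero_add]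
    by_cases h : x = -1
    · subst h
      rw [stepCoeff_left_wall, zero_mul]
    · rw [ih (by omega : x + 1 < 0), mul_zero]

/-! ### The free evolution -/

/-- The solution of `free (N + 1) M = free N (M - 1) + free N (M + 1)` which starts from a unit mass
at `0` and its negative mirror image at `-2`. -/
def free : ℕ → ℤ → ℤ
  | 0, M => (if M = 0 then 1 else 0) - (if M = -2 then 1 else 0)
  | N + 1, M => free N (M - 1) + free N (M + 1)

theorem free_reflect (N : ℕ) (M : ℤ) : free N (-2 - M) = -free N M := by
  induction N generalizing M with
  | zero =>
    simp only [free]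
    split_ifs <;> omega
  | succ N ih =>
    simp only [free]
    rw [show -2 - M - 1 = -2 - (M + 1) by ring, show -2 - M + 1 = -2 - (M - 1) by ring, ih, ih]
    ring

theorem free_eq_zero_of_lt {N : ℕ} {M : ℤ} (h : (N : ℤ) < M) : free N M = 0 := by
  induction N generalizing M with
  | zero =>
    simp only [free]
    split_ifs <;> omega
  | succ N ih =>
    push_cast at h
    simp only [free]
    rw [ih (by omega), ih (by omega), add_zero]

theorem binom_natCast (n : ℕ) {m : ℤ} (hm : 0 ≤ m) : binom n m = n.choose m.toNat := by
  unfold binom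
  split_ifs with h
  · simp
  · rw [Nat.choose_eq_zero_of_lt (by omega), Nat.cast_zero]

theorem binom_of_neg (n : ℤ) {m : ℤ} (hm : m < 0) : binom n m = 0 :=
  if_neg (by omega)

theorem binom_succ (n : ℕ) (m : ℤ) : binom (n + 1 : ℕ) m = binom n (m - 1) + binom n m := by
  rcases lt_trichotomy m 0 with h | rfl | h
  · rw [binom_of_neg _ h, binom_of_neg _ h, binom_of_neg _ (by omega), add_zero]
  · rw [binom_natCast _ le_rfl, binom_natCast _ le_rfl, binom_of_neg _ (by omega)]
    simp
  · rw [binom_natCast _ h.le, binom_natCast _ h.le, binom_natCast _ (by omega)]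
    obtain ⟨k, rfl⟩ : ∃ k : ℕ, m = k + 1 := ⟨(m - 1).toNat, by omega⟩
    rw [add_sub_cancel_right, Int.toNat_natCast, show ((k : ℤ) + 1).toNat = k + 1 by omega,
      Nat.choose_succ_succ]
    push_cast
    rfl

/-- The parity condition is needed: `free` vanishes off the lattice, whereas the floor division in
`F` does not see the parity. -/
theorem F_eq_free {N : ℕ} {M : ℤ} (h : 2 ∣ (N : ℤ) - M) : F N M = free N M := by
  induction N generalizing M with
  | zero =>
    obtain ⟨m, hm⟩ := h
    have hM : M = -(2 * m) := by
      rw [← hm]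
      simp
    rw [F, hm, Int.mul_ediv_cancel_left _ two_ne_zero, hM]
    simp only [binom, free]
    split_ifs <;> first | omega | (simp [show m = 0 by omega]) | (simp [show m = 1 by omega])
  | succ N ih =>
    obtain ⟨m, hm⟩ := h
    have hM : M = N + 1 - 2 * m := by
      push_cast at hm
      omega
    rw [free, ← ih ⟨m, by omega⟩, ← ih ⟨m - 1, by omega⟩]
    unfold F
    rw [hm, Int.mul_ediv_cancel_left _ two_ne_zero, show (N : ℤ) - (M - 1) = 2 * m by omega,
      Int.mul_ediv_cancel_left _ two_ne_zero, show (N : ℤ) - (M + 1) = 2 * (m - 1) by omega,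
      Int.mul_ediv_cancel_left _ two_ne_zero, binom_succ, binom_succ]
    ring

/-! ### The power series of the strips -/

open PowerSeries

/-- The series `1 / (1 - X²)ⁿ⁺¹`. -/
noncomputable def evenSeries (n : ℕ) : PowerSeries ℤ :=
  mk fun m => if Even m then ((m / 2 + n).choose n : ℤ) else 0

theorem coeff_evenSeries_two_mul (n k : ℕ) :
    coeff (2 * k) (evenSeries n) = ((k + n).choose n : ℤ) := by
  simp [evenSeries, coeff_mk]

theorem coeff_evenSeries_two_mul_add_one (n k : ℕ) : coeff (2 * k + 1) (evenSeries n) = 0 := by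
  rw [evenSeries, coeff_mk, if_neg (by simp)]

theorem one_sub_X_sq_mul_evenSeries (n : ℕ) :
    (1 - X ^ 2) * evenSeries (n + 1) = evenSeries n := by
  ext m
  rw [sub_mul, one_mul, map_sub, coeff_X_pow_mul']
  rcases Nat.even_or_odd' m with ⟨k, rfl | rfl⟩
  · rcases k with _ | k
    · rw [if_neg (by omega), coeff_evenSeries_two_mul, coeff_evenSeries_two_mul]
      simp
    · rw [if_pos (by omega), show 2 * (k + 1) - 2 = 2 * k by omega, coeff_evenSeries_two_mul,
        coeff_evenSeries_two_mul, coeff_evenSeries_two_mul,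
        show k + 1 + (n + 1) = (k + (n + 1)) + 1 by ring, Nat.choose_succ_succ,
        show k + (n + 1) = k + 1 + n by ring]
      push_cast
      ring
  · rw [coeff_evenSeries_two_mul_add_one, coeff_evenSeries_two_mul_add_one]
    split_ifs with h
    · rw [show 2 * k + 1 - 2 = 2 * (k - 1) + 1 by omega, coeff_evenSeries_two_mul_add_one, sub_zero]
    · rw [sub_zero]

/-- The series `1 / ((1 - X) (1 + X)ⁿ)`, written as `(1 - X)ⁿ⁻¹ / (1 - X²)ⁿ` for `n > 0`. -/
noncomputable def stripSeries : ℕ → PowerSeries ℤ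
  | 0 => mk 1
  | n + 1 => (1 - X) ^ n * evenSeries n

theorem one_add_X_mul_stripSeries (n : ℕ) : (1 + X) * stripSeries (n + 1) = stripSeries n := by
  rcases n with _ | n
  · ext m
    rw [stripSeries, stripSeries, pow_zero, one_mul, add_mul, one_mul, map_add, coeff_mk]
    rcases Nat.even_or_odd' m with ⟨k, rfl | rfl⟩
    · rcases k with _ | k
      · rw [coeff_evenSeries_two_mul]
        simp
      · rw [show 2 * (k + 1) = 2 * k + 1 + 1 by ring, coeff_succ_X_mul,
          coeff_evenSeries_two_mul_add_one, show 2 * k + 1 + 1 = 2 * (k + 1) by ring,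
          coeff_evenSeries_two_mul]
        simp
    · rw [coeff_succ_X_mul, coeff_evenSeries_two_mul_add_one, coeff_evenSeries_two_mul]
      simp
  · rw [stripSeries, stripSeries, ← one_sub_X_sq_mul_evenSeries n]
    ring

theorem one_sub_X_mul_stripSeries_zero : (1 - X) * stripSeries 0 = 1 := by
  rw [mul_comm]
  exact mk_one_mul_one_sub_eq_one ℤ

theorem coeff_zero_stripSeries (n : ℕ) : coeff 0 (stripSeries n) = 1 := by
  rcases n with _ | n
  · rw [stripSeries, coeff_mk, Pi.one_apply]
  · have h := coeff_evenSeries_two_mul n 0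
    simp only [mul_zero, coeff_zero_eq_constantCoeff] at h
    simp [stripSeries, h]

/-- The binomial expansion of `(1 - X)ⁿ` with even and odd exponents paired. The range goes beyond
the degree `n`, as in the definitions of `P` and `Q`; the additional summands vanish. -/
theorem coeff_stripSeries_succ (n m : ℕ) :
    coeff m (stripSeries (n + 1)) =
      ∑ i ∈ Finset.range ((n + 2) / 2 + 1),
        ((n.choose (2 * i) : ℤ) * (if 2 * i ≤ m then coeff (m - 2 * i) (evenSeries n) else 0) -
          (n.choose (2 * i + 1) : ℤ) *
            (if 2 * i + 1 ≤ m then coeff (m - (2 * i + 1)) (evenSeries n) else 0)) := by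
  have hpair : ∀ (g : ℕ → ℤ) (K : ℕ), ∑ i ∈ Finset.range (2 * K), g i =
      ∑ i ∈ Finset.range K, (g (2 * i) + g (2 * i + 1)) := by
    intro g K
    induction K with
    | zero => simp
    | succ K ih =>
      rw [Finset.sum_range_succ, ← ih, mul_add, mul_one, Finset.sum_range_succ,
        Finset.sum_range_succ, add_assoc]
  have hcoeff : coeff m (stripSeries (n + 1)) = ∑ i ∈ Finset.range (n + 1),
      (-1) ^ i * (n.choose i : ℤ) * (if i ≤ m then coeff (m - i) (evenSeries n) else 0) := by
    rw [stripSeries, sub_eq_neg_add, add_pow, Finset.sum_mul, map_sum]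
    refine Finset.sum_congr rfl fun i _ => ?_
    rw [one_pow, mul_one, neg_pow, ← coeff_X_pow_mul', ← coeff_C_mul]
    congr 1
    simp only [map_mul, map_pow, map_neg, map_one, map_natCast]
    ring
  rw [hcoeff, Finset.sum_subset (s₂ := Finset.range (2 * ((n + 2) / 2 + 1))), hpair]
  · refine Finset.sum_congr rfl fun i _ => ?_
    rw [pow_succ, pow_mul]
    ring
  · exact Finset.range_mono (by omega)
  · intro i _ hi
    rw [Finset.mem_range] at hi
    rw [Nat.choose_eq_zero_of_lt (by omega)]
    simp

/-- The binomial coefficients in `P` and `Q` vanish for `k < i` although their upper argument may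
still be nonnegative. -/
theorem binom_shift (n k i : ℕ) :
    binom ((k : ℤ) - i + ((n + 2 : ℕ) : ℤ) - 2) (((n + 2 : ℕ) : ℤ) - 2) =
      if i ≤ k then ((k - i + n).choose n : ℤ) else 0 := by
  rw [show (((n + 2 : ℕ) : ℤ) - 2) = n by push_cast; ring]
  split_ifs with h
  · rw [show ((k : ℤ) - i + ((n + 2 : ℕ) : ℤ) - 2) = (k - i + n : ℕ) by push_cast [h]; ring,
      binom_natCast _ (by omega), Int.toNat_natCast]
  · rw [binom, if_neg (by push_cast; omega)]

theorem coeff_even_stripSeries (n k : ℕ) :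
    coeff (2 * k) (stripSeries (n + 1)) = P (n + 2) k := by
  rw [coeff_stripSeries_succ, P]
  refine Finset.sum_congr rfl fun i _ => ?_
  rw [binom_shift, show (((n + 2 : ℕ) : ℤ) - 2) = n by push_cast; ring,
    binom_natCast _ (by omega), show (2 * (i : ℤ)).toNat = 2 * i by omega]
  have hodd :
      (if 2 * i + 1 ≤ 2 * k then coeff (2 * k - (2 * i + 1)) (evenSeries n) else 0) = 0 := by
    split_ifs with h
    · rw [show 2 * k - (2 * i + 1) = 2 * (k - i - 1) + 1 by omega,
        coeff_evenSeries_two_mul_add_one]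
    · rfl
  rw [hodd, mul_zero, sub_zero]
  congr 1
  by_cases h : i ≤ k
  · rw [if_pos h, if_pos (by omega), ← Nat.mul_sub, coeff_evenSeries_two_mul]
  · rw [if_neg h, if_neg (by omega)]

theorem coeff_odd_stripSeries (n k : ℕ) :
    coeff (2 * k + 1) (stripSeries (n + 1)) = -Q (n + 2) k := by
  rw [coeff_stripSeries_succ, Q, ← Finset.sum_neg_distrib]
  refine Finset.sum_congr rfl fun i _ => ?_
  rw [binom_shift, show (((n + 2 : ℕ) : ℤ) - 2) = n by push_cast; ring,
    binom_natCast _ (by omega), show (2 * (i : ℤ) + 1).toNat = 2 * i + 1 by omega]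
  have heven : (if 2 * i ≤ 2 * k + 1 then coeff (2 * k + 1 - 2 * i) (evenSeries n) else 0) = 0 := by
    split_ifs with h
    · rw [show 2 * k + 1 - 2 * i = 2 * (k - i) + 1 by omega, coeff_evenSeries_two_mul_add_one]
    · rfl
  rw [heven, mul_zero, zero_sub]
  congr 2
  by_cases h : i ≤ k
  · rw [if_pos h, if_pos (by omega), show 2 * k + 1 - (2 * i + 1) = 2 * (k - i) by omega,
      coeff_evenSeries_two_mul]
  · rw [if_neg h, if_neg (by omega)]

/-! ### Solution in the strips -/

/-- The action of a power series on `free N`, where `X` is the shift by `2 l`, truncated after `K`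
terms. For `N ≤ K`, `0 < K`, `2 ≤ l` and `-1 ≤ M` the omitted terms vanish. -/
noncomputable def shiftAct (l K : ℕ) (p : PowerSeries ℤ) (N : ℕ) (M : ℤ) : ℤ :=
  ∑ k ∈ Finset.range K, coeff k p * free N (M + 2 * l * k)

theorem shiftAct_succ (l K : ℕ) (p : PowerSeries ℤ) (N : ℕ) (M : ℤ) :
    shiftAct l K p (N + 1) M = shiftAct l K p N (M - 1) + shiftAct l K p N (M + 1) := by
  simp only [shiftAct, ← Finset.sum_add_distrib, free]
  refine Finset.sum_congr rfl fun k _ => ?_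
  rw [← mul_add, sub_add_eq_add_sub, add_right_comm]

theorem shiftAct_add (l K : ℕ) (p q : PowerSeries ℤ) (N : ℕ) (M : ℤ) :
    shiftAct l K (p + q) N M = shiftAct l K p N M + shiftAct l K q N M := by
  simp only [shiftAct, ← Finset.sum_add_distrib, map_add, add_mul]

theorem shiftAct_sub (l K : ℕ) (p q : PowerSeries ℤ) (N : ℕ) (M : ℤ) :
    shiftAct l K (p - q) N M = shiftAct l K p N M - shiftAct l K q N M := by
  simp only [shiftAct, ← Finset.sum_sub_distrib, map_sub, sub_mul]

theorem shiftAct_one (l K N : ℕ) (M : ℤ) : shiftAct l (K + 1) 1 N M = free N M := by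
  rw [shiftAct, Finset.sum_range_succ', Finset.sum_eq_zero fun k _ => ?_]
  · simp
  · simp [coeff_one]

/-- The truncation is harmless: the last term on the right lies beyond the support of `free N`. -/
theorem shiftAct_X_mul {l K N : ℕ} (hl : 2 ≤ l) (hK : N ≤ K) (p : PowerSeries ℤ) {M : ℤ}
    (hM : -1 ≤ M) :
    shiftAct l (K + 1) (X * p) N M = shiftAct l (K + 1) p N (M + 2 * l) := by
  have h4 : (2 : ℤ) * (K + 1) ≤ l * (K + 1) := by
    have : (2 : ℤ) ≤ l := by exact_mod_cast hl
    gcongr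
  rw [shiftAct, Finset.sum_range_succ', shiftAct, Finset.sum_range_succ]
  rw [free_eq_zero_of_lt (M := M + 2 * l + 2 * l * K) (by linarith), mul_zero,
    coeff_zero_X_mul, zero_mul]
  refine congrArg (· + 0) (Finset.sum_congr rfl fun k _ => ?_)
  rw [coeff_succ_X_mul]
  congr 2
  push_cast
  ring

/-- The closed form of the weighted count in strip `n + 1`. The truncated subtraction in
`2 ^ (n - 1)` gives the factor `1` for both `n = 0` and `n = 1`: the filter of type 1 between the first two strips
does not double the step arriving from the left. -/
noncomputable def stripValue (l K n N : ℕ) (M : ℤ) : ℤ :=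
  2 ^ (n - 1) * (shiftAct l K (stripSeries n) N M -
    shiftAct l K (stripSeries n) N (2 * (n + 1) * l - 2 - M))

theorem stripValue_succ (l K n N : ℕ) (M : ℤ) :
    stripValue l K n (N + 1) M = stripValue l K n N (M - 1) + stripValue l K n N (M + 1) := by
  simp only [stripValue, shiftAct_succ]
  rw [show 2 * ((n : ℤ) + 1) * l - 2 - M - 1 = 2 * (n + 1) * l - 2 - (M + 1) by ring,
    show 2 * ((n : ℤ) + 1) * l - 2 - M + 1 = 2 * (n + 1) * l - 2 - (M - 1) by ring]
  ring

theorem stripValue_right_end (l K n N : ℕ) {M : ℤ} (hM : M = (n + 1) * l - 1) :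
    stripValue l K n N M = 0 := by
  rw [stripValue, show 2 * ((n : ℤ) + 1) * l - 2 - M = M by rw [hM]; ring, sub_self, mul_zero]

theorem stripValue_wall {l K N : ℕ} (hl : 2 ≤ l) (hK : N ≤ K) :
    stripValue l (K + 1) 0 N (-1) = 0 := by
  have h := shiftAct_X_mul hl hK (stripSeries 0) (le_refl (-1))
  have h1 : shiftAct l (K + 1) ((1 - X) * stripSeries 0) N (-1) = 0 := by
    rw [one_sub_X_mul_stripSeries_zero, shiftAct_one]
    have := free_reflect N (-1)
    norm_num at this
    omega
  rw [sub_mul, one_mul, shiftAct_sub, h] at h1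
  rw [stripValue, show 2 * (((0 : ℕ) : ℤ) + 1) * l - 2 - -1 = -1 + 2 * l by push_cast; ring, h1,
    mul_zero]

/-- The compatibility of neighbouring strips at a filter: what the free evolution would bring in
from the left of the filter is what the two steps arriving at the filter bring in. -/
theorem stripValue_left_end {l K n N : ℕ} (hl : 2 ≤ l) (hK : N ≤ K) {M : ℤ}
    (hM : M = (n + 1) * l - 1) :
    stripValue l (K + 1) (n + 1) N (M - 1) - stripValue l (K + 1) (n + 1) N (M + 1) =
      (if n = 0 then 1 else 2) * stripValue l (K + 1) n N (M - 1) := by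
  have hM0 : 1 ≤ M := by
    have h2 : (2 : ℤ) ≤ l := by exact_mod_cast hl
    have : (0 : ℤ) ≤ n * l := by positivity
    rw [hM]
    linarith
  have key : ∀ x : ℤ, -1 ≤ x → shiftAct l (K + 1) (stripSeries n) N x =
      shiftAct l (K + 1) (stripSeries (n + 1)) N x +
        shiftAct l (K + 1) (stripSeries (n + 1)) N (x + 2 * l) := by
    intro x hx
    rw [← shiftAct_X_mul hl hK _ hx, ← shiftAct_add, ← one_add_X_mul_stripSeries n, add_mul,
      one_mul]
  have hpow : (2 : ℤ) ^ (n + 1 - 1) = (if n = 0 then 1 else 2) * 2 ^ (n - 1) := by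
    rcases n with _ | n
    · simp
    · simp [pow_succ, mul_comm]
  simp only [stripValue]
  rw [hpow, show 2 * ((n : ℤ) + 1) * l - 2 - (M - 1) = M + 1 by rw [hM]; ring,
    show 2 * (((n + 1 : ℕ) : ℤ) + 1) * l - 2 - (M - 1) = M + 1 + 2 * l by
      rw [hM]; push_cast; ring,
    show 2 * (((n + 1 : ℕ) : ℤ) + 1) * l - 2 - (M + 1) = M - 1 + 2 * l by
      rw [hM]; push_cast; ring,
    key (M - 1) (by omega), key (M + 1) (by omega)]
  ring

theorem shiftAct_zero {l K : ℕ} (p : PowerSeries ℤ) (hp : coeff 0 p = 1) {M : ℤ} (hM : 0 ≤ M)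
    (hl : 2 ≤ l) : shiftAct l (K + 1) p 0 M = if M = 0 then 1 else 0 := by
  rw [shiftAct, Finset.sum_range_succ', Finset.sum_eq_zero fun k _ => ?_, hp]
  · simp only [free]
    rw [Nat.cast_zero, mul_zero, add_zero, if_neg (show M ≠ -2 by omega)]
    ring
  · rw [free_eq_zero_of_lt, mul_zero]
    push_cast
    have : (0 : ℤ) < 2 * l * (k + 1) := by positivity
    linarith

theorem weightedCount_eq_stripValue {l K : ℕ} (hl : 2 ≤ l) {N : ℕ} (hK : N ≤ K) {n : ℕ} {M : ℤ}
    (h0 : 0 ≤ M) (h1 : (n : ℤ) * l - 1 ≤ M) (h2 : M ≤ n * l + l - 2) :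
    weightedCount (arrangement l) N (0, 0) (M, (N : ℤ)) = stripValue l (K + 1) n N M := by
  have hl' : (2 : ℤ) ≤ l := by exact_mod_cast hl
  induction N generalizing n M with
  | zero =>
    have hn : (0 : ℤ) ≤ n * l := by positivity
    rw [Nat.cast_zero, weightedCount_zero, stripValue,
      shiftAct_zero _ (coeff_zero_stripSeries n) h0 hl,
      shiftAct_zero _ (coeff_zero_stripSeries n) (by linarith) hl,
      if_neg (by linarith : ¬ 2 * ((n : ℤ) + 1) * l - 2 - M = 0), sub_zero]
    split_ifs with h
    · have : n = 0 := by
        by_contra hne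
        have : (1 : ℤ) ≤ n := by exact_mod_cast Nat.one_le_iff_ne_zero.2 hne
        nlinarith
      simp [this]
    · simp
  | succ N ih =>
    have hNK : N ≤ K := by omega
    rw [Nat.cast_succ, weightedCount_succ, stripValue_succ]
    -- The contribution from the right: at the right end of the strip, both sides vanish.
    have hright : ∀ m : ℕ, (m : ℤ) * l ≤ M → M ≤ m * l + l - 2 →
        stepCoeff (arrangement l) (M + 1, (N : ℤ)) (M, (N : ℤ) + 1) *
          weightedCount (arrangement l) N (0, 0) (M + 1, (N : ℤ)) =
            stripValue l (K + 1) m N (M + 1) := by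
      intro m hm1 hm2
      by_cases hM : M + 1 = m * l + l - 1
      · rw [stepCoeff_left_of_filter (n := m) (by rw [hM]; push_cast; ring), zero_mul,
          stripValue_right_end]
        rw [hM]
        ring
      · rw [stepCoeff_left h0 (ne_filter_of_mem_strip hm1 hm2)
          (ne_filter_of_mem_strip (n := m) (by omega) (by omega)), one_mul,
          ih hNK (n := m) (by omega) (by omega) (by omega)]
    by_cases hM : M = n * l - 1
    · obtain _ | n := n
      · simp at hM
        omega
      have hM' : M = (n + 1) * l - 1 := by
        rw [hM]
        push_cast
        ring
      have hM'' : M = (n + 1 : ℕ) * l - 1 := hM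
      have hn : (0 : ℤ) ≤ n * l := by positivity
      -- Only here does a strip receive weight from its left neighbour.
      rw [stepCoeff_right_filter hl hM'',
        ih hNK (n := n) (by linarith) (by linarith) (by linarith),
        stepCoeff_left_filter hM'' h0 (ne_filter_of_mem_strip (n := n + 1) (by omega) (by omega)),
        ih hNK (n := n + 1) (by omega) (by omega) (by omega), ← stripValue_left_end hl hNK hM']
      ring
    · have hM1 : (n : ℤ) * l ≤ M := by omega
      rw [hright n hM1 h2, stepCoeff_right (ne_filter_of_mem_strip hM1 h2), one_mul]
      congr 1
      by_cases hM0 : M = 0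
      · subst hM0
        have : n = 0 := by
          by_contra hne
          have : (1 : ℤ) ≤ n := by exact_mod_cast Nat.one_le_iff_ne_zero.2 hne
          nlinarith
        subst this
        rw [weightedCount_of_neg l N (by omega), zero_sub, stripValue_wall hl hNK]
      · exact ih hNK (by omega) (by omega) (by omega)

/-! ### Extraction of the four sums -/

theorem sum_Icc_eq_sum_range {u : ℤ} {K : ℕ} (hu : u < K) (g : ℤ → ℤ)
    (hg : ∀ k : ℕ, u < k → g k = 0) :
    ∑ k ∈ Finset.Icc (0 : ℤ) u, g k = ∑ k ∈ Finset.range K, g k := by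
  have h : ∑ k ∈ Finset.range K, g k = ∑ k ∈ (Finset.range K).map Nat.castEmbedding, g k := by
    rw [Finset.sum_map]
    rfl
  rw [h]
  refine Finset.sum_subset ?_ ?_
  · intro k hk
    rw [Finset.mem_Icc] at hk
    rw [Finset.mem_map]
    refine ⟨k.toNat, Finset.mem_range.2 (by omega), ?_⟩
    simp [hk.1]
  · intro k hk hk'
    obtain ⟨m, -, rfl⟩ := Finset.mem_map.1 hk
    rw [Finset.mem_Icc] at hk'
    simp only [Nat.castEmbedding_apply] at hk' ⊢
    exact hg m (by omega)

theorem shiftAct_stripSeries_succ (l K n N : ℕ) (M : ℤ) :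
    shiftAct l (2 * K) (stripSeries (n + 1)) N M =
      (∑ k ∈ Finset.range K, P (n + 2) k * free N (M + 4 * k * l)) -
        ∑ k ∈ Finset.range K, Q (n + 2) k * free N (M + 2 * l + 4 * k * l) := by
  unfold shiftAct
  induction K with
  | zero => simp
  | succ K ih =>
    rw [mul_add, mul_one, Finset.sum_range_succ, Finset.sum_range_succ, ih,
      Finset.sum_range_succ, Finset.sum_range_succ, coeff_even_stripSeries,
      coeff_odd_stripSeries,
      show M + 2 * l * ((2 * K : ℕ) : ℤ) = M + 4 * K * l by push_cast; ring,
      show M + 2 * l * ((2 * K + 1 : ℕ) : ℤ) = M + 2 * l + 4 * K * l by push_cast; ring]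
    ring

/-- Beyond the upper limit `(N - a) / (4 l)`, which is at most `N` when `0 ≤ a`, the summands
vanish. -/
theorem sum_Icc_mul_F {l N : ℕ} (hl : 2 ≤ l) {a : ℤ} (ha : 0 ≤ a) (c h g : ℤ → ℤ)
    (hgh : ∀ k : ℕ, g k = h k) (hh : ∀ k : ℕ, (N : ℤ) < a + 4 * k * l → h k = 0) :
    ∑ k ∈ Finset.Icc (0 : ℤ) ((N - a) / (4 * l)), c k * g k =
      ∑ k ∈ Finset.range (N + 1), c k * h k := by
  have hl' : (2 : ℤ) ≤ l := by exact_mod_cast hl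
  rw [sum_Icc_eq_sum_range (K := N + 1)]
  · exact Finset.sum_congr rfl fun k _ => by rw [hgh]
  · rw [Int.ediv_lt_iff_lt_mul (by linarith)]
    push_cast
    nlinarith
  · intro k hk
    rw [hgh, hh, mul_zero]
    rw [Int.ediv_lt_iff_lt_mul (by linarith)] at hk
    linarith

end FilterPaths

open FilterPaths in
/-- `⌊(M + 1) / l + 1⌋ = j` says that the endpoint lies in the `j`-th strip
`(j - 1) l - 1 ≤ M ≤ j l - 2`. All divisions of integers are floor divisions, and a sum whose
upper limit is negative is empty. -/
theorem mainTheorem1 (l j N : ℕ) (M : ℤ) (hl : 2 ≤ l) (hj : 2 ≤ j)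
    (hMN : (M, (N : ℤ)) ∈ FilterPaths.lattice)
    (hstrip : ⌊((M : ℚ) + 1) / (l : ℚ) + 1⌋ = (j : ℤ)) :
    FilterPaths.weightedCount (FilterPaths.arrangement l) N (0, 0) (M, (N : ℤ)) =
      2 ^ (j - 2) *
        ((∑ k ∈ Finset.Icc (0 : ℤ) (((N : ℤ) - (j - 1) * l + 1) / (4 * l)),
            FilterPaths.P j k * FilterPaths.F N (M + 4 * k * l))
        + (∑ k ∈ Finset.Icc (0 : ℤ) (((N : ℤ) - j * l) / (4 * l)),
            FilterPaths.P j k * FilterPaths.F N (M - 4 * k * l - 2 * j * l))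
        - (∑ k ∈ Finset.Icc (0 : ℤ) (((N : ℤ) - (j + 1) * l + 1) / (4 * l)),
            FilterPaths.Q j k * FilterPaths.F N (M + 2 * l + 4 * k * l))
        - (∑ k ∈ Finset.Icc (0 : ℤ) (((N : ℤ) - (j + 2) * l) / (4 * l)),
            FilterPaths.Q j k * FilterPaths.F N (M - 4 * k * l - 2 * (j + 1) * l))) := by
  have hl' : (2 : ℤ) ≤ l := by exact_mod_cast hl
  obtain ⟨n, rfl⟩ : ∃ n, j = n + 2 := ⟨j - 2, by omega⟩
  have hlQ : (0 : ℚ) < l := by exact_mod_cast (by omega : 0 < l)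
  rw [Int.floor_eq_iff] at hstrip
  have h1 : ((n : ℤ) + 1) * l - 1 ≤ M := by
    have h : ((n : ℚ) + 1) ≤ (M + 1) / l := by
      have := hstrip.1
      push_cast at this
      linarith
    rw [le_div_iff₀ hlQ] at h
    have h' : ((n : ℤ) + 1) * l ≤ M + 1 := by exact_mod_cast h
    linarith
  have h2 : M ≤ ((n : ℤ) + 1) * l + l - 2 := by
    have h : ((M : ℚ) + 1) / l < n + 2 := by
      have := hstrip.2
      push_cast at this
      linarith
    rw [div_lt_iff₀ hlQ] at h
    have h' : M + 1 < ((n : ℤ) + 2) * l := by exact_mod_cast h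
    linarith
  have hnl : (0 : ℤ) ≤ n * l := by positivity
  have hpar : (2 : ℤ) ∣ M + N := hMN
  -- All arguments of `F` have the parity of `N`, where `F` agrees with `free`.
  have hF : ∀ x : ℤ, F N (M + 2 * x) = free N (M + 2 * x) := fun x => F_eq_free (by omega)
  rw [weightedCount_eq_stripValue (K := 2 * N + 1) hl (by omega) (n := n + 1) (by linarith)
    (by push_cast; linarith) (by push_cast; linarith), stripValue,
    show 2 * N + 1 + 1 = 2 * (N + 1) by ring, shiftAct_stripSeries_succ,
    shiftAct_stripSeries_succ]
  push_cast
  rw [show (N : ℤ) - (n + 2 - 1) * l + 1 = N - ((n + 2 - 1) * l - 1) by ring,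
    show (N : ℤ) - (n + 2 + 1) * l + 1 = N - ((n + 2 + 1) * l - 1) by ring,
    sum_Icc_mul_F hl (by linarith) (P (n + 2)) (fun k => free N (M + 4 * k * l)),
    sum_Icc_mul_F hl (by linarith) (P (n + 2))
      (fun k => -free N (2 * (n + 1 + 1) * l - 2 - M + 4 * k * l)),
    sum_Icc_mul_F hl (by linarith) (Q (n + 2)) (fun k => free N (M + 2 * l + 4 * k * l)),
    sum_Icc_mul_F hl (by linarith) (Q (n + 2))
      (fun k => -free N (2 * (n + 1 + 1) * l - 2 - M + 2 * l + 4 * k * l))]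
  · simp only [mul_neg, Finset.sum_neg_distrib]
    ring
  · intro k
    rw [← free_reflect, show M - 4 * k * l - 2 * (n + 2 + 1) * l =
      M + 2 * (-(2 * k * l) - (n + 2 + 1) * l) by ring, hF]
    congr 1
    ring
  · intro k hk
    rw [free_eq_zero_of_lt, neg_zero]
    linarith
  · intro k
    rw [show M + 2 * l + 4 * k * l = M + 2 * (l + 2 * k * l) by ring, hF]
  · intro k hk
    rw [free_eq_zero_of_lt]
    linarith
  · intro k
    rw [← free_reflect, show M - 4 * k * l - 2 * (n + 2) * l =
      M + 2 * (-(2 * k * l) - (n + 2) * l) by ring, hF]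
    congr 1
    ring
  · intro k hk
    rw [free_eq_zero_of_lt, neg_zero]
    linarith
  · intro k
    rw [show M + 4 * k * l = M + 2 * (2 * k * l) by ring, hF]
  · intro k hk
    rw [free_eq_zero_of_lt]
    linarith
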